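/- **Theorem.** Fix constants $\mu,\hbar,V_0,V_{\mathrm{so}},R>0$ and $V_q\in\mathbb R$. For $\ell\in\mathbb N_0=\{0,1,2,\dots\}$ and $j\in\{\ell+\tfrac12,\ell-\tfrac12\}$ (only $j=\tfrac12$ if $\ell=0$) put $$\xi_{\ell j}=\tfrac12\bigl(j(j+1)-\ell(\ell+1)-\tfrac34\bigr),\qquad \alpha=\alpha_{\ell j}=-\frac{2\mu}{\hbar^2}V_{\mathrm{so}}\,\xi_{\ell j},\qquad \beta=-\frac{2\mu}{\hbar^2}V_q ,$$ and assume $\beta\neq\pm2$. A bound state of energy $E\in(-V_0,0)$ with quantum numbers $\ell,j$ of the spherical well with a $\delta$–$\delta'$ interaction at its edge, $$-\frac{\hbar^2}{2\mu}\Bigl[\frac{d^2}{dr^2}-\frac{\ell(\ell+1)}{r^2}\Bigr]+V_0\,[\theta(r-R)-1]-V_{\mathrm{so}}\,\xi_{\ell j}\,\delta(r-R)-V_q\,\delta'(r-R),$$ is a nonzero real function $u\in L^2(0,\infty)$, twice differentiable on $(0,R)\cup(R,\infty)$, with $u(0^+)=0$, which satisfies $$-\frac{\hbar^2}{2\mu}\Bigl[u''(r)-\frac{\ell(\ell+1)}{r^2}u(r)\Bigr]+V_0\,[\theta(r-R)-1]\,u(r)=E\,u(r)\qquad(r>0,\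 r\neq R)$$ and the matching conditions (all one-sided limits existing) $$\begin{pmatrix}u(R^+)\\u'(R^+)\end{pmatrix}=\begin{pmatrix}\frac{2+\beta}{2-\beta}&0\\[2pt]\frac{4\alpha}{4-\beta^2}&\frac{2-\beta}{2+\beta}\end{pmatrix}\begin{pmatrix}u(R^-)\\u'(R^-)\end{pmatrix}.$$ Its radial quantum number $n\in\mathbb N_0$ is the number of zeros of $u$ in $(0,R)\cup(R,\infty)$, and its relative energy is $\varepsilon_{n\ell j}=|E|/V_0\in(0,1)$. Then for all $n,\ell\in\mathbb N_0$, whenever the bound states that occur in the respective inequality exist: (a) $-\varepsilon_{n\ell j}<-\varepsilon_{(n+1)\ell j}$ for every admissible $j$; (b) $-\varepsilon_{n\ell j}<-\varepsilon_{n(\ell+1)j}$ for $j=\ell+\tfrac12$; (c) $-\varepsilon_{n\ell,\,\ell+1/2}<-\varepsilon_{n\ell,\,\ell-1/2}$ if $\ell>0$. -/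

import Mathlib

open Set Filter Topology MeasureTheory

noncomputable section

/-- Physical parameters of a particle in a spherical well of depth `V0` and radius `R` with a
`δ`-`δ'` interaction on its edge: reduced mass `mass`, reduced Planck constant `hbar`,
spin-orbit strength `Vso > 0` (coupled to the `δ` term) and strength `Vq` of the `δ'` term
(of either sign). -/
structure ShellModel where
  /-- reduced mass -/
  mass : ℝ
  /-- reduced Planck constant -/
  hbar : ℝ
  /-- depth of the well -/
  V0 : ℝ
  /-- spin-orbit strength -/
  Vso : ℝ
  /-- strength of the `δ'` term -/
  Vq : ℝ
  /-- radius of the well -/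
  R : ℝ
  mass_pos : 0 < mass
  hbar_pos : 0 < hbar
  V0_pos : 0 < V0
  Vso_pos : 0 < Vso
  R_pos : 0 < R

/-- The values of the total angular momentum `j` of a spin `1/2` particle with orbital angular
momentum `ℓ`: `j = ℓ + 1/2`, and also `j = ℓ - 1/2` if `ℓ > 0`. -/
def IsTotalAngularMomentum (ℓ : ℕ) (j : ℝ) : Prop :=
  j = ℓ + 1 / 2 ∨ (0 < ℓ ∧ j = ℓ - 1 / 2)

/-- `ξ_{ℓ j}`: the eigenvalue of `L · S` in units of `ħ ^ 2`. -/
def spinOrbit (ℓ : ℕ) (j : ℝ) : ℝ :=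
  (j * (j + 1) - ℓ * (ℓ + 1) - 3 / 4) / 2

namespace ShellModel

/-- The coefficient `α` of `δ(r - R)`, equal to `-(2 μ / ħ ^ 2) V_so ξ_{ℓ j}`. -/
def alpha (P : ShellModel) (ℓ : ℕ) (j : ℝ) : ℝ :=
  -(2 * P.mass / P.hbar ^ 2) * P.Vso * spinOrbit ℓ j

/-- The coefficient `β` of `δ'(r - R)`, equal to `-(2 μ / ħ ^ 2) V_q`. -/
def beta (P : ShellModel) : ℝ :=
  -(2 * P.mass / P.hbar ^ 2) * P.Vq

/-- The regular part `V0 (θ(r - R) - 1)` of the potential. -/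
def well (P : ShellModel) (r : ℝ) : ℝ :=
  if r < P.R then -P.V0 else 0

/-- The matrix sending `(u(R⁻), u'(R⁻))` to `(u(R⁺), u'(R⁺))`, by which the interaction
`α δ(r - R) + β δ'(r - R)` is defined (for `β ≠ 2` and `β ≠ -2`). -/
def matchingMatrix (P : ShellModel) (ℓ : ℕ) (j : ℝ) : Matrix (Fin 2) (Fin 2) ℝ :=
  !![(2 + P.beta) / (2 - P.beta), 0;
     4 * P.alpha ℓ j / (4 - P.beta ^ 2), (2 - P.beta) / (2 + P.beta)]

/-- `u` is the reduced radial wave function of a bound state of energy `E` with quantum numbers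
`ℓ`, `j`: a nonzero square integrable function on `(0, ∞)` vanishing at the origin, which solves
the radial Schrödinger equation away from `r = R` and satisfies the matching conditions of the
`δ`-`δ'` interaction at `r = R`. The value `u R` and the values on `(-∞, 0]` play no role. -/
structure IsBoundState (P : ShellModel) (ℓ : ℕ) (j E : ℝ) (u : ℝ → ℝ) : Prop where
  nontrivial : ∃ r, 0 < r ∧ r ≠ P.R ∧ u r ≠ 0
  memLp : MemLp u 2 (volume.restrict (Ioi 0))
  origin : Tendsto u (𝓝[>] 0) (𝓝 0)
  differentiableAt : ∀ r, 0 < r → r ≠ P.R → DifferentiableAt ℝ u r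
  differentiableAt_deriv : ∀ r, 0 < r → r ≠ P.R → DifferentiableAt ℝ (deriv u) r
  schrodinger : ∀ r, 0 < r → r ≠ P.R →
    -(P.hbar ^ 2 / (2 * P.mass)) * (deriv (deriv u) r - ℓ * (ℓ + 1) / r ^ 2 * u r)
      + P.well r * u r = E * u r
  matching : ∃ uL duL uR duR : ℝ,
    Tendsto u (𝓝[<] P.R) (𝓝 uL) ∧ Tendsto (deriv u) (𝓝[<] P.R) (𝓝 duL) ∧
    Tendsto u (𝓝[>] P.R) (𝓝 uR) ∧ Tendsto (deriv u) (𝓝[>] P.R) (𝓝 duR) ∧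
    ![uR, duR] = (P.matchingMatrix ℓ j).mulVec ![uL, duL]

/-- The nodes of a reduced radial wave function: its zeros in `(0, R) ∪ (R, ∞)`. -/
def nodes (P : ShellModel) (u : ℝ → ℝ) : Set ℝ :=
  {r | 0 < r ∧ r ≠ P.R ∧ u r = 0}

/-- `ε` is a relative energy `ε_{n ℓ j} = |E| / V0`: there is a bound state of energy
`E ∈ (-V0, 0)` with quantum numbers `ℓ`, `j` and radial quantum number `n`, the number of nodes
of its reduced radial wave function. -/
def IsRelativeEnergy (P : ShellModel) (n ℓ : ℕ) (j ε : ℝ) : Prop :=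
  ∃ (E : ℝ) (u : ℝ → ℝ), -P.V0 < E ∧ E < 0 ∧ P.IsBoundState ℓ j E u ∧
    (P.nodes u).encard = n ∧ ε = |E| / P.V0

end ShellModel

end

/-! The argument is Sturm comparison through the Wronskian `W = u v' - u' v`. If `u'' = q₁ u` and
`v'' = q₂ v`, then `W' = (q₂ - q₁) u v`. Lowering `E` or raising `ℓ` raises the coefficient, so `u`
oscillates at least as fast as `v` whenever `E₂ ≤ E₁` and `ℓ₁ ≤ ℓ₂`.

Outside the well a square integrable solution decays, so a bound state with finitely many nodes has
all of them in `(0, R)`. There the nodes of `v` inject into those of `u`, each going to a node no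
larger (`exists_injOn_zeros`). Hence `v` has at most as many nodes as `u`, which gives (a) by
contradiction, whatever happens at the edge.

For (b) and (c) the numbers of nodes agree, so the injection is onto and neither function vanishes
between the last node of `v` (or the origin) and `R`. This makes `u v W` nonnegative at `R⁻`, while
decay makes it nonpositive at `R⁺`. The matching changes `W` by a positive multiple of `(α₂ - α₁) u
v`, so `α₂ ≤ α₁` (`alpha_le_of_encard_nodes_eq`). But `α` is nonpositive for `j = ℓ + 1/2` and
positive for `j = ℓ - 1/2`, so the energies cannot be in the wrong order. -/

/-- `u` is twice differentiable on `s` and solves `u'' = q u` there. -/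
def SolvesOn (q u : ℝ → ℝ) (s : Set ℝ) : Prop :=
  ∀ r ∈ s, DifferentiableAt ℝ u r ∧ DifferentiableAt ℝ (deriv u) r ∧
    deriv (deriv u) r = q r * u r

/-- The Wronskian of two functions. -/
noncomputable def wronskian (u v : ℝ → ℝ) (r : ℝ) : ℝ :=
  u r * deriv v r - deriv u r * v r

namespace SolvesOn

variable {q q₁ q₂ u v : ℝ → ℝ} {s t : Set ℝ}

theorem mono (h : SolvesOn q u t) (hst : s ⊆ t) : SolvesOn q u s :=
  fun r hr => h r (hst hr)

theorem const_mul (h : SolvesOn q u s) (c : ℝ) : SolvesOn q (fun r => c * u r) s := by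
  intro r hr
  obtain ⟨h1, h2, h3⟩ := h r hr
  have e : deriv (fun r => c * u r) = fun r => c * deriv u r := by
    funext x; exact deriv_const_mul_field c
  rw [e, deriv_const_mul_field, h3]
  exact ⟨h1.const_mul c, h2.const_mul c, by ring⟩

theorem continuousOn (h : SolvesOn q u s) : ContinuousOn u s :=
  fun r hr => (h r hr).1.continuousAt.continuousWithinAt

theorem hasDerivAt_wronskian (hu : SolvesOn q₁ u s) (hv : SolvesOn q₂ v s) {r : ℝ} (hr : r ∈ s) :
    HasDerivAt (wronskian u v) ((q₂ r - q₁ r) * (u r * v r)) r := by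
  obtain ⟨h1, h2, h3⟩ := hu r hr
  obtain ⟨k1, k2, k3⟩ := hv r hr
  have := (h1.hasDerivAt.mul k2.hasDerivAt).sub (h2.hasDerivAt.mul k1.hasDerivAt)
  rw [h3, k3] at this
  refine this.congr_deriv ?_
  ring

theorem monotoneOn_wronskian (hu : SolvesOn q₁ u s) (hv : SolvesOn q₂ v s) (hs : Convex ℝ s)
    (hq : ∀ r ∈ interior s, q₁ r ≤ q₂ r) (huv : ∀ r ∈ interior s, 0 ≤ u r * v r) :
    MonotoneOn (wronskian u v) s := by
  have hd : ∀ r ∈ s, HasDerivAt (wronskian u v) ((q₂ r - q₁ r) * (u r * v r)) r :=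
    fun r hr => hu.hasDerivAt_wronskian hv hr
  refine monotoneOn_of_deriv_nonneg hs
    (fun r hr => (hd r hr).continuousAt.continuousWithinAt)
    (fun r hr => (hd r (interior_subset hr)).differentiableAt.differentiableWithinAt) ?_
  intro r hr
  rw [(hd r (interior_subset hr)).deriv]
  exact mul_nonneg (sub_nonneg.2 (hq r hr)) (huv r hr)

end SolvesOn

theorem wronskian_const_mul (u v : ℝ → ℝ) (c d r : ℝ) :
    wronskian (fun r => c * u r) (fun r => d * v r) r = c * d * wronskian u v r := by
  simp only [wronskian, deriv_const_mul_field]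
  ring

/-- A continuous function without zeros on an interval has constant sign. -/
theorem exists_sign_pos {f : ℝ → ℝ} {s : Set ℝ} (hs : s.OrdConnected) (hf : ContinuousOn f s)
    (h0 : ∀ x ∈ s, f x ≠ 0) : ∃ σ : ℝ, ∀ x ∈ s, 0 < σ * f x := by
  by_cases h : ∀ x ∈ s, 0 < f x
  · exact ⟨1, by simpa using h⟩
  · push Not at h
    obtain ⟨x, hx, hfx⟩ := h
    refine ⟨-1, fun y hy => ?_⟩
    by_contra hc
    have hy0 : 0 ≤ f y := by linarith
    obtain ⟨z, hz, hz0⟩ := hs.isPreconnected.intermediate_value hx hy hf ⟨hfx, hy0⟩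
    exact h0 z hz hz0

theorem deriv_nonneg_of_pos_right {f : ℝ → ℝ} {p b : ℝ} (hpb : p < b)
    (hf : DifferentiableAt ℝ f p) (h0 : f p = 0) (hpos : ∀ x ∈ Ioo p b, 0 < f x) :
    0 ≤ deriv f p := by
  have h := (hasDerivAt_iff_tendsto_slope.1 hf.hasDerivAt).mono_left
    (nhdsWithin_mono p (fun x (hx : x ∈ Ioi p) => (ne_of_gt hx : x ≠ p)))
  refine ge_of_tendsto h ?_
  filter_upwards [Ioo_mem_nhdsGT hpb] with x hx
  rw [slope_def_field, h0, sub_zero]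
  exact div_nonneg (hpos x hx).le (sub_nonneg.2 hx.1.le)

/-! ### Behaviour at the singular endpoint `0` -/

section Origin

variable {q q₁ q₂ u v : ℝ → ℝ} {b C : ℝ}

/-- A positive function tending to zero at the origin has points of nonnegative slope arbitrarily
close to the origin. -/
theorem exists_deriv_nonneg_near_zero (hb : 0 < b) (hv : ∀ r ∈ Ioo 0 b, DifferentiableAt ℝ v r)
    (hpos : ∀ r ∈ Ioo 0 b, 0 < v r) (h0 : Tendsto v (𝓝[>] 0) (𝓝 0)) :
    ∃ s ∈ Ioo 0 b, 0 ≤ deriv v s := by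
  by_contra! hneg
  have hanti : AntitoneOn v (Ioo 0 b) := by
    refine antitoneOn_of_deriv_nonpos (convex_Ioo 0 b)
      (fun r hr => (hv r hr).continuousAt.continuousWithinAt) ?_ ?_
    · rw [interior_Ioo]; exact fun r hr => (hv r hr).differentiableWithinAt
    · rw [interior_Ioo]; exact fun r hr => (hneg r hr).le
  have hm : b / 2 ∈ Ioo 0 b := ⟨by linarith, by linarith⟩
  have : v (b / 2) ≤ 0 := by
    refine ge_of_tendsto h0 ?_
    filter_upwards [Ioo_mem_nhdsGT hm.1] with r hr
    exact hanti ⟨hr.1, hr.2.trans hm.2⟩ hm hr.2.le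
  exact absurd (hpos _ hm) this.not_gt

/-- Near the origin `0 < u < 1`, so `u'' = q u ≥ -C` and `u' + C r` is nondecreasing. Only a lower
bound on `q` is needed, which the centrifugal singularity respects. -/
theorem SolvesOn.deriv_bddAbove_near_zero (hb : 0 < b) (hu : SolvesOn q u (Ioo 0 b))
    (hq : ∀ r ∈ Ioo 0 b, -C ≤ q r) (hC : 0 ≤ C)
    (hpos : ∀ r ∈ Ioo 0 b, 0 < u r) (h0 : Tendsto u (𝓝[>] 0) (𝓝 0)) :
    ∃ K, 0 < K ∧ ∀ᶠ r in 𝓝[>] 0, deriv u r ≤ K := by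
  obtain ⟨d, hd, hd1⟩ := mem_nhdsGT_iff_exists_Ioo_subset.1 (h0.eventually (gt_mem_nhds one_pos))
  set e := min d b with he
  have he0 : 0 < e := lt_min hd hb
  have hsub : Ioo 0 e ⊆ Ioo 0 b := Ioo_subset_Ioo_right (min_le_right _ _)
  have hD : ∀ r ∈ Ioo 0 e, HasDerivAt (fun r => deriv u r + C * r) (q r * u r + C) r := by
    intro r hr
    obtain ⟨-, h2, h3⟩ := hu r (hsub hr)
    have := h2.hasDerivAt.add ((hasDerivAt_id r).const_mul C)
    rw [h3, mul_one] at this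
    exact this
  have hmono : MonotoneOn (fun r => deriv u r + C * r) (Ioo 0 e) := by
    refine monotoneOn_of_deriv_nonneg (convex_Ioo 0 e)
      (fun r hr => (hD r hr).continuousAt.continuousWithinAt) ?_ ?_
    · rw [interior_Ioo]; exact fun r hr => (hD r hr).differentiableAt.differentiableWithinAt
    · rw [interior_Ioo]
      intro r hr
      rw [(hD r hr).deriv]
      have h1 : u r < 1 := hd1 ⟨hr.1, hr.2.trans_le (min_le_left _ _)⟩
      have h2 := hpos r (hsub hr)
      have h3 := hq r (hsub hr)
      nlinarith [mul_le_mul_of_nonneg_right h3 h2.le]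
  have hm : e / 2 ∈ Ioo 0 e := ⟨by linarith, by linarith⟩
  -- The summand `1` makes the bound positive, so that it can be divided by later.
  refine ⟨|deriv u (e / 2) + C * (e / 2)| + 1, by positivity, ?_⟩
  filter_upwards [Ioo_mem_nhdsGT hm.1] with r hr
  have h1 := hmono ⟨hr.1, hr.2.trans hm.2⟩ hm hr.2.le
  have h2 := le_abs_self (deriv u (e / 2) + C * (e / 2))
  have h3 := mul_nonneg hC hr.1.le
  simp only at h1
  linarith

/-- No limit of `u'` or `v'` at the origin is available. Instead, at points `s` near `0` with `v' s
≥ 0`, one has `W s ≥ -u' s * v s ≥ -K * v s`, which is arbitrarily close to `0`; monotonicity of `W`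
carries the bound to `r`. -/
theorem wronskian_nonneg_of_origin (hb : 0 < b) (hu : SolvesOn q₁ u (Ioo 0 b))
    (hv : SolvesOn q₂ v (Ioo 0 b)) (hq : ∀ r ∈ Ioo 0 b, q₁ r ≤ q₂ r)
    (hC : 0 ≤ C) (hqC : ∀ r ∈ Ioo 0 b, -C ≤ q₁ r)
    (hu0 : ∀ r ∈ Ioo 0 b, 0 < u r) (hv0 : ∀ r ∈ Ioo 0 b, 0 < v r)
    (hul : Tendsto u (𝓝[>] 0) (𝓝 0)) (hvl : Tendsto v (𝓝[>] 0) (𝓝 0)) :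
    ∀ r ∈ Ioo 0 b, 0 ≤ wronskian u v r := by
  intro r hr
  have hmono : MonotoneOn (wronskian u v) (Ioo 0 b) :=
    hu.monotoneOn_wronskian hv (convex_Ioo 0 b) (by rwa [interior_Ioo])
      (by rw [interior_Ioo]; exact fun x hx => (mul_pos (hu0 x hx) (hv0 x hx)).le)
  obtain ⟨K, hK, hKu⟩ := hu.deriv_bddAbove_near_zero hb hqC hC hu0 hul
  refine le_of_forall_pos_lt_add fun ε hε => ?_
  have hvε := hvl.eventually (gt_mem_nhds (div_pos hε hK))
  obtain ⟨d, hd, hdsub⟩ := mem_nhdsGT_iff_exists_Ioo_subset.1 (hKu.and hvε)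
  have he : 0 < min d r := lt_min hd hr.1
  obtain ⟨s, hs, hs0⟩ := exists_deriv_nonneg_near_zero he
    (fun x hx => (hv x ⟨hx.1, (hx.2.trans_le (min_le_right _ _)).trans hr.2⟩).1)
    (fun x hx => hv0 x ⟨hx.1, (hx.2.trans_le (min_le_right _ _)).trans hr.2⟩) hvl
  have hsr : s < r := hs.2.trans_le (min_le_right _ _)
  have hsb : s ∈ Ioo 0 b := ⟨hs.1, hsr.trans hr.2⟩
  obtain ⟨h1, h2⟩ := hdsub ⟨hs.1, hs.2.trans_le (min_le_left _ _)⟩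
  have h3 := hmono hsb hr hsr.le
  have h4 := mul_nonneg (hu0 s hsb).le hs0
  have h5 := mul_le_mul_of_nonneg_right h1 (hv0 s hsb).le
  rw [lt_div_iff₀ hK] at h2
  unfold wronskian at h3 ⊢
  linarith

end Origin

/-! ### Sturm comparison inside the well -/

section Comparison

variable {q₁ q₂ u v : ℝ → ℝ} {p b R C : ℝ}

theorem wronskian_nonneg_of_zero (hpb : p < b) (hu : SolvesOn q₁ u (Ico p b))
    (hv : SolvesOn q₂ v (Ico p b)) (hq : ∀ r ∈ Ioo p b, q₁ r ≤ q₂ r)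
    (hu0 : ∀ r ∈ Ioo p b, 0 < u r) (hv0 : ∀ r ∈ Ioo p b, 0 < v r) (hvp : v p = 0) :
    ∀ r ∈ Ioo p b, 0 ≤ wronskian u v r := by
  intro r hr
  have hp : p ∈ Ico p b := ⟨le_rfl, hpb⟩
  have hmono : MonotoneOn (wronskian u v) (Ico p b) :=
    hu.monotoneOn_wronskian hv (convex_Ico p b) (by rwa [interior_Ico])
      (by rw [interior_Ico]; exact fun x hx => (mul_pos (hu0 x hx) (hv0 x hx)).le)
  have hup : 0 ≤ u p := by
    refine ge_of_tendsto ((hu p hp).1.continuousAt.tendsto.mono_left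
      (nhdsWithin_le_nhds (s := Ioi p))) ?_
    filter_upwards [Ioo_mem_nhdsGT hpb] with x hx using (hu0 x hx).le
  have h1 := hmono hp (Ioo_subset_Ico_self hr) hr.1.le
  have h2 := mul_nonneg hup (deriv_nonneg_of_pos_right hpb (hv p hp).1 hvp hv0)
  refine le_trans ?_ h1
  simpa [wronskian, hvp] using h2

/-- Sturm's comparison of two solutions on an interval whose left end is the origin or a zero of
the slower oscillating one. -/
theorem wronskian_nonneg (hp : p = 0 ∨ 0 < p ∧ v p = 0) (hpb : p < b) (hbR : b ≤ R)
    (hu : SolvesOn q₁ u (Ioo 0 R)) (hv : SolvesOn q₂ v (Ioo 0 R))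
    (hq : ∀ r ∈ Ioo 0 R, q₁ r ≤ q₂ r) (hC : 0 ≤ C) (hqC : ∀ r ∈ Ioo 0 R, -C ≤ q₁ r)
    (hul : Tendsto u (𝓝[>] 0) (𝓝 0)) (hvl : Tendsto v (𝓝[>] 0) (𝓝 0))
    (hu0 : ∀ r ∈ Ioo p b, 0 < u r) (hv0 : ∀ r ∈ Ioo p b, 0 < v r) :
    ∀ r ∈ Ioo p b, 0 ≤ wronskian u v r := by
  rcases hp with rfl | ⟨hp, hvp⟩
  · have hsub : Ioo 0 b ⊆ Ioo 0 R := Ioo_subset_Ioo_right hbR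
    exact wronskian_nonneg_of_origin hpb (hu.mono hsub) (hv.mono hsub)
      (fun r hr => hq r (hsub hr)) hC (fun r hr => hqC r (hsub hr)) hu0 hv0 hul hvl
  · have hsub : Ico p b ⊆ Ioo 0 R := fun x hx => ⟨hp.trans_le hx.1, hx.2.trans_le hbR⟩
    exact wronskian_nonneg_of_zero hpb (hu.mono hsub) (hv.mono hsub)
      (fun r hr => hq r (hsub (Ioo_subset_Ico_self hr))) hu0 hv0 hvp

theorem monotoneOn_div_of_wronskian_nonneg (hu : SolvesOn q₁ u (Ioc p b))
    (hv : SolvesOn q₂ v (Ioc p b)) (hu0 : ∀ r ∈ Ioc p b, u r ≠ 0)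
    (hW : ∀ r ∈ Ioo p b, 0 ≤ wronskian u v r) :
    MonotoneOn (fun r => v r / u r) (Ioc p b) := by
  have hd : ∀ r ∈ Ioc p b, HasDerivAt (fun r => v r / u r) (wronskian u v r / u r ^ 2) r := by
    intro r hr
    refine ((hv r hr).1.hasDerivAt.div (hu r hr).1.hasDerivAt (hu0 r hr)).congr_deriv ?_
    rw [wronskian]
    ring
  refine monotoneOn_of_deriv_nonneg (convex_Ioc p b)
    (fun r hr => (hd r hr).continuousAt.continuousWithinAt) ?_ ?_
  · rw [interior_Ioc]
    exact fun r hr => (hd r (Ioo_subset_Ioc_self hr)).differentiableAt.differentiableWithinAt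
  · rw [interior_Ioc]
    intro r hr
    rw [(hd r (Ioo_subset_Ioc_self hr)).deriv]
    exact div_nonneg (hW r hr) (sq_nonneg _)

theorem tendsto_const_mul_zero (c : ℝ) (hul : Tendsto u (𝓝[>] 0) (𝓝 0)) :
    Tendsto (fun r => c * u r) (𝓝[>] 0) (𝓝 0) := by
  simpa using hul.const_mul c

/-- Sturm's comparison theorem: between the origin or a zero of `v` and the next zero of `v`, the
faster oscillating `u` has a zero. -/
theorem exists_zero_of_comparison (hp : p = 0 ∨ 0 < p ∧ v p = 0) (hpb : p < b) (hbR : b < R)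
    (hu : SolvesOn q₁ u (Ioo 0 R)) (hv : SolvesOn q₂ v (Ioo 0 R))
    (hq : ∀ r ∈ Ioo 0 R, q₁ r ≤ q₂ r) (hC : 0 ≤ C) (hqC : ∀ r ∈ Ioo 0 R, -C ≤ q₁ r)
    (hul : Tendsto u (𝓝[>] 0) (𝓝 0)) (hvl : Tendsto v (𝓝[>] 0) (𝓝 0))
    (hv0 : ∀ r ∈ Ioo p b, v r ≠ 0) (hvb : v b = 0) : ∃ x ∈ Ioc p b, u x = 0 := by
  by_contra! hu0
  have hp0 : 0 ≤ p := by rcases hp with rfl | ⟨h, -⟩ <;> linarith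
  have hsub : Ioc p b ⊆ Ioo 0 R := fun x hx => ⟨hp0.trans_lt hx.1, hx.2.trans_lt hbR⟩
  obtain ⟨σ, hσ⟩ := exists_sign_pos ordConnected_Ioc (hu.mono hsub).continuousOn hu0
  obtain ⟨τ, hτ⟩ := exists_sign_pos ordConnected_Ioo
    (hv.mono (Ioo_subset_Ioc_self.trans hsub)).continuousOn hv0
  have hW := wronskian_nonneg (u := fun r => σ * u r) (v := fun r => τ * v r)
    (hp.imp_right fun h => ⟨h.1, by simp [h.2]⟩) hpb hbR.le
    (hu.const_mul σ) (hv.const_mul τ) hq hC hqC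
    (tendsto_const_mul_zero σ hul) (tendsto_const_mul_zero τ hvl)
    (fun r hr => hσ r (Ioo_subset_Ioc_self hr)) hτ
  have hm := monotoneOn_div_of_wronskian_nonneg ((hu.const_mul σ).mono hsub)
    ((hv.const_mul τ).mono hsub) (fun r hr => (hσ r hr).ne') hW
  -- The nondecreasing quotient `v / u` would be positive at `m` and zero at `b`.
  obtain ⟨m, hm1, hm2⟩ := exists_between hpb
  have h1 := hm ⟨hm1, hm2.le⟩ ⟨hpb, le_rfl⟩ hm2.le
  have h2 := div_pos (hτ m ⟨hm1, hm2⟩) (hσ m ⟨hm1, hm2.le⟩)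
  simp only [hvb, mul_zero, zero_div] at h1
  linarith

/-- The largest element below `b` of the union of a finite set and `{0}`. -/
theorem exists_predecessor {Z : Set ℝ} (hZ : Z.Finite) (hb : 0 < b) :
    ∃ p, (p = 0 ∨ p ∈ Z) ∧ p < b ∧ ∀ z ∈ Z, z < b → z ≤ p := by
  have hfin : ({z ∈ insert 0 Z | z < b}).Finite := (hZ.insert 0).subset (sep_subset _ _)
  obtain ⟨p, hp, hmax⟩ := hfin.exists_maximalFor id _ ⟨0, mem_insert _ _, hb⟩
  refine ⟨p, hp.1, hp.2, fun z hz hzb => ?_⟩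
  by_contra! h
  exact absurd (hmax (j := z) ⟨mem_insert_of_mem _ hz, hzb⟩ h.le) h.not_ge

/-- The zeros of the slower oscillating solution inject into those of the faster oscillating one,
each being sent to a zero that is not larger. -/
theorem exists_injOn_zeros
    (hu : SolvesOn q₁ u (Ioo 0 R)) (hv : SolvesOn q₂ v (Ioo 0 R))
    (hq : ∀ r ∈ Ioo 0 R, q₁ r ≤ q₂ r) (hC : 0 ≤ C) (hqC : ∀ r ∈ Ioo 0 R, -C ≤ q₁ r)
    (hul : Tendsto u (𝓝[>] 0) (𝓝 0)) (hvl : Tendsto v (𝓝[>] 0) (𝓝 0))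
    (hfin : {r ∈ Ioo 0 R | v r = 0}.Finite) :
    ∃ f : ℝ → ℝ, InjOn f {r ∈ Ioo 0 R | v r = 0} ∧
      ∀ z ∈ {r ∈ Ioo 0 R | v r = 0}, f z ∈ {r ∈ Ioo 0 R | u r = 0} ∧ f z ≤ z := by
  have key : ∀ z ∈ {r ∈ Ioo 0 R | v r = 0}, ∃ x, x ∈ {r ∈ Ioo 0 R | u r = 0} ∧ x ≤ z ∧
      ∀ w ∈ {r ∈ Ioo 0 R | v r = 0}, w < z → w < x := by
    rintro z ⟨hz, hvz⟩
    obtain ⟨p, hp, hpz, hmax⟩ := exists_predecessor hfin hz.1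
    have hp0 : 0 ≤ p := by rcases hp with rfl | h; exacts [le_rfl, h.1.1.le]
    obtain ⟨x, hx, hx0⟩ := exists_zero_of_comparison (hp.imp_right fun h => ⟨h.1.1, h.2⟩) hpz hz.2
      hu hv hq hC hqC hul hvl
      (fun r hr h => (hmax r ⟨⟨hp0.trans_lt hr.1, hr.2.trans hz.2⟩, h⟩ hr.2).not_gt hr.1) hvz
    exact ⟨x, ⟨⟨hp0.trans_lt hx.1, hx.2.trans_lt hz.2⟩, hx0⟩, hx.2,
      fun w hw hwz => (hmax w hw hwz).trans_lt hx.1⟩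
  choose! f hf hfz hlt using key
  refine ⟨f, StrictMonoOn.injOn fun a ha c hc hac => ?_, fun z hz => ⟨hf z hz, hfz z hz⟩⟩
  -- The zero chosen for `c` lies beyond every earlier zero of `v`, in particular beyond `a ≥ f a`.
  exact (hfz a ha).trans_lt (hlt c hc a ha hac)

end Comparison

/-! ### Decay and comparison outside the well -/

section Exterior

variable {q q₁ q₂ u v : ℝ → ℝ} {R : ℝ}

/-- A square integrable solution in a classically forbidden region decays. -/
theorem SolvesOn.mul_deriv_nonpos (hu : SolvesOn q u (Ioi R)) (hq : ∀ r ∈ Ioi R, 0 ≤ q r)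
    (hint : IntegrableOn (fun r => u r ^ 2) (Ioi R)) : ∀ r ∈ Ioi R, u r * deriv u r ≤ 0 := by
  have hD : ∀ r ∈ Ioi R, HasDerivAt (fun r => u r * deriv u r)
      (deriv u r ^ 2 + q r * u r ^ 2) r := by
    intro r hr
    obtain ⟨h1, h2, h3⟩ := hu r hr
    refine (h1.hasDerivAt.mul h2.hasDerivAt).congr_deriv ?_
    rw [h3]; ring
  have hmono : MonotoneOn (fun r => u r * deriv u r) (Ioi R) := by
    refine monotoneOn_of_deriv_nonneg (convex_Ioi R)
      (fun r hr => (hD r hr).continuousAt.continuousWithinAt) ?_ ?_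
    · rw [interior_Ioi]; exact fun r hr => (hD r hr).differentiableAt.differentiableWithinAt
    · rw [interior_Ioi]
      intro r hr
      rw [(hD r hr).deriv]
      exact add_nonneg (sq_nonneg _) (mul_nonneg (hq r hr) (sq_nonneg _))
  intro x hx
  by_contra! hpos
  have hux : 0 < u x ^ 2 := by
    have : u x ≠ 0 := by rintro h; simp [h] at hpos
    positivity
  have hsub : Ici x ⊆ Ioi R := Ici_subset_Ioi.2 hx
  have hE : ∀ r ∈ Ici x, HasDerivAt (fun r => u r ^ 2) (2 * (u r * deriv u r)) r := by
    intro r hr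
    refine ((hu r (hsub hr)).1.hasDerivAt.pow 2).congr_deriv ?_
    push_cast; ring
  have hsq : MonotoneOn (fun r => u r ^ 2) (Ici x) := by
    refine monotoneOn_of_deriv_nonneg (convex_Ici x)
      (fun r hr => (hE r hr).continuousAt.continuousWithinAt)
      (fun r hr => (hE r (interior_subset hr)).differentiableAt.differentiableWithinAt) ?_
    intro r hr
    have hr' := interior_subset hr
    rw [(hE r hr').deriv]
    have := hmono hx (hsub hr') hr'
    simp only at this
    linarith
  -- Once `u u'` is positive it stays so, and `u ^ 2` dominates a positive constant on a ray of
  -- infinite measure.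
  have hconst : IntegrableOn (fun _ : ℝ => u x ^ 2) (Ici x) := by
    refine Integrable.mono' (hint.mono_set hsub) aestronglyMeasurable_const ?_
    filter_upwards [ae_restrict_mem measurableSet_Ici] with r hr
    rw [Real.norm_of_nonneg hux.le]
    exact hsq (self_mem_Ici) hr hr
  rw [integrableOn_const_iff (by simp)] at hconst
  simp [Real.volume_Ici, (pow_ne_zero_iff two_ne_zero).1 hux.ne'] at hconst

theorem SolvesOn.antitoneOn_sq (hu : SolvesOn q u (Ioi R))
    (hdecay : ∀ r ∈ Ioi R, u r * deriv u r ≤ 0) : AntitoneOn (fun r => u r ^ 2) (Ioi R) := by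
  have hE : ∀ r ∈ Ioi R, HasDerivAt (fun r => u r ^ 2) (2 * (u r * deriv u r)) r := by
    intro r hr
    refine ((hu r hr).1.hasDerivAt.pow 2).congr_deriv ?_
    push_cast; ring
  refine antitoneOn_of_deriv_nonpos (convex_Ioi R)
    (fun r hr => (hE r hr).continuousAt.continuousWithinAt)
    (fun r hr => (hE r (interior_subset hr)).differentiableAt.differentiableWithinAt) ?_
  intro r hr
  rw [(hE r (interior_subset hr)).deriv]
  linarith [hdecay r (interior_subset hr)]

/-- Since `u ^ 2` is nonincreasing, one zero would make `u` vanish on a whole ray. -/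
theorem SolvesOn.ne_zero_of_finite (hu : SolvesOn q u (Ioi R))
    (hdecay : ∀ r ∈ Ioi R, u r * deriv u r ≤ 0) (hfin : {r ∈ Ioi R | u r = 0}.Finite) :
    ∀ r ∈ Ioi R, u r ≠ 0 := by
  intro r hr h0
  refine (Ioi_infinite r) (hfin.subset fun x hx => ⟨Ioi_subset_Ioi (le_of_lt hr) hx, ?_⟩)
  have h := hu.antitoneOn_sq hdecay hr (Ioi_subset_Ioi (le_of_lt hr) hx) (le_of_lt hx)
  simp only [h0] at h
  exact pow_eq_zero_iff two_ne_zero |>.1 (le_antisymm (by simpa using h) (sq_nonneg _))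

theorem SolvesOn.limit_ne_zero (hu : SolvesOn q u (Ioi R))
    (hdecay : ∀ r ∈ Ioi R, u r * deriv u r ≤ 0) (hne : ∀ r ∈ Ioi R, u r ≠ 0) {uR : ℝ}
    (hlim : Tendsto u (𝓝[>] R) (𝓝 uR)) : uR ≠ 0 := by
  rintro rfl
  have hR : R + 1 ∈ Ioi R := by simp
  have h2 : Tendsto (fun r => u r ^ 2) (𝓝[>] R) (𝓝 0) := by simpa using hlim.pow 2
  have h : u (R + 1) ^ 2 ≤ 0 := by
    refine ge_of_tendsto h2 ?_
    filter_upwards [Ioo_mem_nhdsGT (show R < R + 1 by linarith)] with x hx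
    exact hu.antitoneOn_sq hdecay hx.1 hR hx.2.le
  exact hne _ hR (pow_eq_zero_iff two_ne_zero |>.1 (le_antisymm h (sq_nonneg _)))

/-- This replaces asymptotics at infinity. If `w > 0`, then `W ≥ w` throughout; since `u v' ≤ 0` and
`v` is nonincreasing, `u'` stays below a negative constant, and `u` cannot remain positive. -/
theorem wronskian_limit_nonpos_of_pos (hu : SolvesOn q₁ u (Ioi R)) (hv : SolvesOn q₂ v (Ioi R))
    (hq : ∀ r ∈ Ioi R, q₁ r ≤ q₂ r) (hu0 : ∀ r ∈ Ioi R, 0 < u r) (hv0 : ∀ r ∈ Ioi R, 0 < v r)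
    (hu' : ∀ r ∈ Ioi R, u r * deriv u r ≤ 0) (hv' : ∀ r ∈ Ioi R, v r * deriv v r ≤ 0) {w : ℝ}
    (hw : Tendsto (wronskian u v) (𝓝[>] R) (𝓝 w)) : w ≤ 0 := by
  by_contra! hwpos
  have hmono : MonotoneOn (wronskian u v) (Ioi R) :=
    hu.monotoneOn_wronskian hv (convex_Ioi R) (by rwa [interior_Ioi])
      (by rw [interior_Ioi]; exact fun x hx => (mul_pos (hu0 x hx) (hv0 x hx)).le)
  have hwle : ∀ r ∈ Ioi R, w ≤ wronskian u v r := by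
    intro r hr
    refine le_of_tendsto hw ?_
    filter_upwards [Ioo_mem_nhdsGT hr] with x hx using hmono hx.1 hr hx.2.le
  set x := R + 1 with hx
  have hxR : x ∈ Ioi R := by simp [hx]
  have hsub : Ici x ⊆ Ioi R := Ici_subset_Ioi.2 hxR
  have hvx := hv0 x hxR
  have hux := hu0 x hxR
  have hslope : ∀ r ∈ Ici x, deriv u r ≤ -(w / v x) := by
    intro r hr
    have hr' := hsub hr
    have h1 := hwle r hr'
    have hvr := hv0 r hr'
    have h2 : deriv v r ≤ 0 := nonpos_of_mul_nonpos_right (hv' r hr') hvr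
    have h3 : deriv u r ≤ 0 := nonpos_of_mul_nonpos_right (hu' r hr') (hu0 r hr')
    have h4 : v r ≤ v x :=
      (pow_le_pow_iff_left₀ hvr.le hvx.le two_ne_zero).1 (hv.antitoneOn_sq hv' hxR hr' hr)
    have h5 := mul_nonpos_of_nonneg_of_nonpos (hu0 r hr').le h2
    have h6 := mul_le_mul_of_nonneg_left h4 (neg_nonneg.2 h3)
    have h7 : w / v x ≤ -deriv u r := by
      rw [div_le_iff₀ hvx]
      unfold wronskian at h1
      linarith
    linarith
  have hlin := Convex.image_sub_le_mul_sub_of_deriv_le (convex_Ici x)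
    (hu.mono hsub).continuousOn
    (fun r hr => (hu r (hsub (interior_subset hr))).1.differentiableWithinAt)
    (fun r hr => hslope r (interior_subset hr))
  have hge : x ≤ x + u x * v x / w := by
    have : 0 < u x * v x / w := by positivity
    linarith
  -- At this point the line through `(x, u x)` of slope `-(w / v x)` reaches zero.
  have h := hlin x self_mem_Ici (x + u x * v x / w) hge hge
  have h2 := hu0 _ (hsub hge)
  have h3 : -(w / v x) * (x + u x * v x / w - x) = -u x := by
    field_simp
    ring
  linarith

theorem tendsto_wronskian {l : Filter ℝ} {a b c d : ℝ} (hu : Tendsto u l (𝓝 a))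
    (hu' : Tendsto (deriv u) l (𝓝 b)) (hv : Tendsto v l (𝓝 c)) (hv' : Tendsto (deriv v) l (𝓝 d)) :
    Tendsto (wronskian u v) l (𝓝 (a * d - b * c)) :=
  (hu.mul hv').sub (hu'.mul hv)

/-- The factor `a * c` makes the expression quadratic in each of `u` and `v`, so its sign survives
the normalisation to positive functions. -/
theorem exterior_wronskian_nonpos (hu : SolvesOn q₁ u (Ioi R)) (hv : SolvesOn q₂ v (Ioi R))
    (hq : ∀ r ∈ Ioi R, q₁ r ≤ q₂ r) (hu0 : ∀ r ∈ Ioi R, u r ≠ 0) (hv0 : ∀ r ∈ Ioi R, v r ≠ 0)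
    (hu' : ∀ r ∈ Ioi R, u r * deriv u r ≤ 0) (hv' : ∀ r ∈ Ioi R, v r * deriv v r ≤ 0)
    {a b c d : ℝ} (hua : Tendsto u (𝓝[>] R) (𝓝 a)) (hub : Tendsto (deriv u) (𝓝[>] R) (𝓝 b))
    (hvc : Tendsto v (𝓝[>] R) (𝓝 c)) (hvd : Tendsto (deriv v) (𝓝[>] R) (𝓝 d)) :
    a * c * (a * d - b * c) ≤ 0 := by
  obtain ⟨σ, hσ⟩ := exists_sign_pos ordConnected_Ioi hu.continuousOn hu0
  obtain ⟨τ, hτ⟩ := exists_sign_pos ordConnected_Ioi hv.continuousOn hv0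
  have hlim : Tendsto (wronskian (fun r => σ * u r) (fun r => τ * v r)) (𝓝[>] R)
      (𝓝 (σ * τ * (a * d - b * c))) := by
    rw [show wronskian (fun r => σ * u r) (fun r => τ * v r) =
      fun r => σ * τ * wronskian u v r from funext (wronskian_const_mul u v σ τ)]
    exact (tendsto_wronskian hua hub hvc hvd).const_mul _
  have hσ' : ∀ r ∈ Ioi R, σ * u r * deriv (fun r => σ * u r) r ≤ 0 := by
    intro r hr
    rw [deriv_const_mul_field]
    nlinarith [mul_nonneg (sq_nonneg σ) (neg_nonneg.2 (hu' r hr))]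
  have hτ' : ∀ r ∈ Ioi R, τ * v r * deriv (fun r => τ * v r) r ≤ 0 := by
    intro r hr
    rw [deriv_const_mul_field]
    nlinarith [mul_nonneg (sq_nonneg τ) (neg_nonneg.2 (hv' r hr))]
  have h1 := wronskian_limit_nonpos_of_pos (hu.const_mul σ) (hv.const_mul τ) hq hσ hτ hσ' hτ' hlim
  have ha : 0 ≤ σ * a := ge_of_tendsto (hua.const_mul σ)
    (eventually_nhdsWithin_of_forall fun r hr => (hσ r hr).le)
  have hc : 0 ≤ τ * c := ge_of_tendsto (hvc.const_mul τ)
    (eventually_nhdsWithin_of_forall fun r hr => (hτ r hr).le)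
  have hR : R + 1 ∈ Ioi R := by simp
  have hσ0 : 0 < (σ * τ) ^ 2 := by
    have : σ ≠ 0 := fun h => by simpa [h] using hσ _ hR
    have : τ ≠ 0 := fun h => by simpa [h] using hτ _ hR
    positivity
  have h2 := mul_nonpos_of_nonneg_of_nonpos (mul_nonneg ha hc) h1
  refine nonpos_of_mul_nonpos_right (b := a * c * (a * d - b * c)) (a := (σ * τ) ^ 2) ?_ hσ0
  linarith

end Exterior

/-- The counterpart at `R⁻` of `exterior_wronskian_nonpos`, with the opposite sign because `W` is
now controlled from the left. -/
theorem interior_wronskian_nonneg {q₁ q₂ u v : ℝ → ℝ} {p R C : ℝ}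
    (hp : p = 0 ∨ 0 < p ∧ v p = 0) (hpR : p < R)
    (hu : SolvesOn q₁ u (Ioo 0 R)) (hv : SolvesOn q₂ v (Ioo 0 R))
    (hq : ∀ r ∈ Ioo 0 R, q₁ r ≤ q₂ r) (hC : 0 ≤ C) (hqC : ∀ r ∈ Ioo 0 R, -C ≤ q₁ r)
    (hul : Tendsto u (𝓝[>] 0) (𝓝 0)) (hvl : Tendsto v (𝓝[>] 0) (𝓝 0))
    (hu0 : ∀ r ∈ Ioo p R, u r ≠ 0) (hv0 : ∀ r ∈ Ioo p R, v r ≠ 0)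
    {a b c d : ℝ} (hua : Tendsto u (𝓝[<] R) (𝓝 a)) (hub : Tendsto (deriv u) (𝓝[<] R) (𝓝 b))
    (hvc : Tendsto v (𝓝[<] R) (𝓝 c)) (hvd : Tendsto (deriv v) (𝓝[<] R) (𝓝 d)) :
    0 ≤ a * c * (a * d - b * c) := by
  have hp0 : 0 ≤ p := by rcases hp with rfl | ⟨h, -⟩ <;> linarith
  have hsub : Ioo p R ⊆ Ioo 0 R := Ioo_subset_Ioo_left hp0
  obtain ⟨σ, hσ⟩ := exists_sign_pos ordConnected_Ioo (hu.mono hsub).continuousOn hu0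
  obtain ⟨τ, hτ⟩ := exists_sign_pos ordConnected_Ioo (hv.mono hsub).continuousOn hv0
  have hW := wronskian_nonneg (u := fun r => σ * u r) (v := fun r => τ * v r)
    (hp.imp_right fun h => ⟨h.1, by simp [h.2]⟩) hpR le_rfl
    (hu.const_mul σ) (hv.const_mul τ) hq hC hqC
    (tendsto_const_mul_zero σ hul) (tendsto_const_mul_zero τ hvl) hσ hτ
  simp only [wronskian_const_mul] at hW
  have hev := Ioo_mem_nhdsLT hpR
  have h1 : 0 ≤ σ * τ * (a * d - b * c) := by
    refine ge_of_tendsto ((tendsto_wronskian hua hub hvc hvd).const_mul (σ * τ)) ?_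
    filter_upwards [hev] with r hr using hW r hr
  have ha : 0 ≤ σ * a := by
    refine ge_of_tendsto (hua.const_mul σ) ?_
    filter_upwards [hev] with r hr using (hσ r hr).le
  have hc : 0 ≤ τ * c := by
    refine ge_of_tendsto (hvc.const_mul τ) ?_
    filter_upwards [hev] with r hr using (hτ r hr).le
  obtain ⟨m, hm⟩ := nonempty_Ioo.2 hpR
  have hσ0 : 0 < (σ * τ) ^ 2 := by
    have : σ ≠ 0 := fun h => by simpa [h] using hσ m hm
    have : τ ≠ 0 := fun h => by simpa [h] using hτ m hm
    positivity
  have h2 := mul_nonneg (mul_nonneg ha hc) h1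
  refine nonneg_of_mul_nonneg_right (b := a * c * (a * d - b * c)) (a := (σ * τ) ^ 2) ?_ hσ0
  linarith

/-! ### Bound states and the matching at the edge -/

namespace ShellModel

variable {P : ShellModel} {ℓ ℓ₁ ℓ₂ : ℕ} {j j₁ j₂ E E₁ E₂ : ℝ} {u v : ℝ → ℝ}

/-- The coefficient `q` for which the radial Schrödinger equation reads `u'' = q u`. -/
noncomputable def radialCoeff (P : ShellModel) (ℓ : ℕ) (E r : ℝ) : ℝ :=
  ℓ * (ℓ + 1) / r ^ 2 + 2 * P.mass / P.hbar ^ 2 * (P.well r - E)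

theorem radialCoeff_le (hℓ : ℓ₁ ≤ ℓ₂) (hE : E₂ ≤ E₁) (r : ℝ) :
    P.radialCoeff ℓ₁ E₁ r ≤ P.radialCoeff ℓ₂ E₂ r := by
  have := P.mass_pos
  have := P.hbar_pos
  unfold radialCoeff
  gcongr

theorem le_radialCoeff (P : ShellModel) (ℓ : ℕ) (E : ℝ) (r : ℝ) :
    -(2 * P.mass / P.hbar ^ 2 * (P.V0 + |E|)) ≤ P.radialCoeff ℓ E r := by
  have h1 := P.mass_pos
  have h2 := P.hbar_pos
  have h3 := P.V0_pos
  have h4 : -P.V0 ≤ P.well r := by unfold well; split_ifs <;> linarith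
  have h5 : 0 ≤ (ℓ * (ℓ + 1) / r ^ 2 : ℝ) := by positivity
  have h6 : 0 ≤ 2 * P.mass / P.hbar ^ 2 * (P.well r + P.V0 + (|E| - E)) :=
    mul_nonneg (by positivity) (by linarith [le_abs_self E])
  unfold radialCoeff
  linarith

theorem radialCoeff_nonneg (hE : E < 0) {r : ℝ} (hr : P.R < r) : 0 ≤ P.radialCoeff ℓ E r := by
  have h1 := P.mass_pos
  have h2 := P.hbar_pos
  have h3 : P.well r = 0 := by simp [well, hr.le]
  unfold radialCoeff
  rw [h3, zero_sub]
  have : 0 < -E := by linarith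
  positivity

theorem IsBoundState.solvesOn (h : P.IsBoundState ℓ j E u) :
    SolvesOn (P.radialCoeff ℓ E) u {r | 0 < r ∧ r ≠ P.R} := by
  rintro r ⟨hr, hrR⟩
  refine ⟨h.differentiableAt r hr hrR, h.differentiableAt_deriv r hr hrR, ?_⟩
  have h1 := h.schrodinger r hr hrR
  have hm := P.mass_pos.ne'
  have hh := P.hbar_pos.ne'
  have h2 := congrArg (fun x => 2 * P.mass / P.hbar ^ 2 * x) h1
  have h3 : 2 * P.mass / P.hbar ^ 2 * (P.hbar ^ 2 / (2 * P.mass)) = 1 := by field_simp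
  unfold radialCoeff
  linear_combination -h2 - (deriv (deriv u) r - ℓ * (ℓ + 1) / r ^ 2 * u r) * h3

theorem Ioo_subset_punctured (P : ShellModel) : Ioo 0 P.R ⊆ {r | 0 < r ∧ r ≠ P.R} :=
  fun _ hr => ⟨hr.1, hr.2.ne⟩

theorem Ioi_subset_punctured (P : ShellModel) : Ioi P.R ⊆ {r | 0 < r ∧ r ≠ P.R} :=
  fun _ hr => ⟨P.R_pos.trans hr, ne_of_gt hr⟩

theorem IsBoundState.mul_deriv_nonpos (h : P.IsBoundState ℓ j E u) (hE : E < 0) :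
    ∀ r ∈ Ioi P.R, u r * deriv u r ≤ 0 :=
  (h.solvesOn.mono P.Ioi_subset_punctured).mul_deriv_nonpos (fun _ hr => radialCoeff_nonneg hE hr)
    (IntegrableOn.mono_set h.memLp.integrable_sq (Ioi_subset_Ioi P.R_pos.le))

theorem IsBoundState.ne_zero_of_lt (h : P.IsBoundState ℓ j E u) (hE : E < 0)
    (hfin : (P.nodes u).Finite) : ∀ r ∈ Ioi P.R, u r ≠ 0 :=
  (h.solvesOn.mono P.Ioi_subset_punctured).ne_zero_of_finite (h.mul_deriv_nonpos hE)
    (hfin.subset fun _ hr => ⟨P.R_pos.trans hr.1, ne_of_gt hr.1, hr.2⟩)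

theorem IsBoundState.nodes_eq (h : P.IsBoundState ℓ j E u) (hE : E < 0)
    (hfin : (P.nodes u).Finite) : P.nodes u = {r ∈ Ioo 0 P.R | u r = 0} := by
  ext r
  refine ⟨fun ⟨h1, h2, h3⟩ => ⟨⟨h1, ?_⟩, h3⟩, fun ⟨h1, h2⟩ => ⟨h1.1, h1.2.ne, h2⟩⟩
  exact h2.lt_or_gt.resolve_right fun hr => h.ne_zero_of_lt hE hfin r hr h3

theorem exists_injOn_nodes (hu : P.IsBoundState ℓ₁ j₁ E₁ u) (hv : P.IsBoundState ℓ₂ j₂ E₂ v)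
    (hE₁ : E₁ < 0) (hE₂ : E₂ < 0) (hufin : (P.nodes u).Finite) (hvfin : (P.nodes v).Finite)
    (hℓ : ℓ₁ ≤ ℓ₂) (hE : E₂ ≤ E₁) :
    ∃ f : ℝ → ℝ, InjOn f (P.nodes v) ∧ ∀ z ∈ P.nodes v, f z ∈ P.nodes u ∧ f z ≤ z := by
  have hm := P.mass_pos
  have hV := P.V0_pos
  have hfin := hvfin
  rw [hv.nodes_eq hE₂ hvfin] at hfin ⊢
  rw [hu.nodes_eq hE₁ hufin]
  exact exists_injOn_zeros (hu.solvesOn.mono P.Ioo_subset_punctured)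
    (hv.solvesOn.mono P.Ioo_subset_punctured) (fun r _ => radialCoeff_le hℓ hE r)
    (by positivity) (fun r _ => P.le_radialCoeff ℓ₁ E₁ r) hu.origin hv.origin hfin

/-- Lower energy or higher angular momentum cannot increase the number of nodes. -/
theorem encard_nodes_le (hu : P.IsBoundState ℓ₁ j₁ E₁ u) (hv : P.IsBoundState ℓ₂ j₂ E₂ v)
    (hE₁ : E₁ < 0) (hE₂ : E₂ < 0) (hufin : (P.nodes u).Finite) (hvfin : (P.nodes v).Finite)
    (hℓ : ℓ₁ ≤ ℓ₂) (hE : E₂ ≤ E₁) : (P.nodes v).encard ≤ (P.nodes u).encard := by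
  obtain ⟨f, hinj, hf⟩ := exists_injOn_nodes hu hv hE₁ hE₂ hufin hvfin hℓ hE
  exact encard_le_encard_of_injOn (fun z hz => (hf z hz).1) hinj

theorem matching_apply {uL duL uR duR : ℝ}
    (h : ![uR, duR] = (P.matchingMatrix ℓ j).mulVec ![uL, duL]) :
    uR = (2 + P.beta) / (2 - P.beta) * uL ∧
      duR = 4 * P.alpha ℓ j / (4 - P.beta ^ 2) * uL + (2 - P.beta) / (2 + P.beta) * duL := by
  have h0 := congrFun h 0
  have h1 := congrFun h 1
  simp [matchingMatrix, Matrix.mulVec, dotProduct, Fin.sum_univ_two] at h0 h1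
  exact ⟨h0, h1⟩

/-- With the same number of nodes, lower energy or higher angular momentum has to be compensated
by a weaker repulsion at the edge. -/
theorem alpha_le_of_encard_nodes_eq (hβ : P.beta ≠ 2) (hβ' : P.beta ≠ -2)
    (hu : P.IsBoundState ℓ₁ j₁ E₁ u) (hv : P.IsBoundState ℓ₂ j₂ E₂ v)
    (hE₁ : E₁ < 0) (hE₂ : E₂ < 0) (hufin : (P.nodes u).Finite) (hvfin : (P.nodes v).Finite)
    (hℓ : ℓ₁ ≤ ℓ₂) (hE : E₂ ≤ E₁) (hcard : (P.nodes u).encard = (P.nodes v).encard) :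
    P.alpha ℓ₂ j₂ ≤ P.alpha ℓ₁ j₁ := by
  have hm := P.mass_pos
  have hV := P.V0_pos
  obtain ⟨f, hinj, hf⟩ := exists_injOn_nodes hu hv hE₁ hE₂ hufin hvfin hℓ hE
  -- Equal finite cardinalities make `f` onto. As `f z ≤ z`, no node of `u` exceeds the last node of
  -- `v`.
  have himage : f '' P.nodes v = P.nodes u :=
    (hvfin.image f).eq_of_subset_of_encard_le (image_subset_iff.2 fun z hz => (hf z hz).1)
      (by rw [hinj.encard_image, hcard])
  obtain ⟨p, hp, hpR, hmax⟩ := exists_predecessor hvfin P.R_pos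
  have hp0 : 0 ≤ p := by rcases hp with rfl | h; exacts [le_rfl, h.1.le]
  have hv0 : ∀ r ∈ Ioo p P.R, v r ≠ 0 := fun r hr h =>
    (hmax r ⟨hp0.trans_lt hr.1, hr.2.ne, h⟩ hr.2).not_gt hr.1
  have hu0 : ∀ r ∈ Ioo p P.R, u r ≠ 0 := by
    intro r hr h
    have hr' : r ∈ P.nodes u := ⟨hp0.trans_lt hr.1, hr.2.ne, h⟩
    rw [← himage] at hr'
    obtain ⟨z, hz, rfl⟩ := hr'
    have hzR : z < P.R := by
      have hz' := hz
      rw [hv.nodes_eq hE₂ hvfin] at hz'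
      exact hz'.1.2
    exact (((hf z hz).2.trans (hmax z hz hzR)).not_gt hr.1)
  obtain ⟨a, b, a', b', ha, hb, ha', hb', hab⟩ := hu.matching
  obtain ⟨c, d, c', d', hc, hd, hc', hd', hcd⟩ := hv.matching
  obtain ⟨hab1, hab2⟩ := matching_apply hab
  obtain ⟨hcd1, hcd2⟩ := matching_apply hcd
  have hin := interior_wronskian_nonneg (hp.imp_right fun h => ⟨h.1, h.2.2⟩) hpR
    (hu.solvesOn.mono P.Ioo_subset_punctured) (hv.solvesOn.mono P.Ioo_subset_punctured)
    (fun r _ => radialCoeff_le hℓ hE r) (by positivity) (fun r _ => P.le_radialCoeff ℓ₁ E₁ r)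
    hu.origin hv.origin hu0 hv0 ha hb hc hd
  have husol := hu.solvesOn.mono P.Ioi_subset_punctured
  have hvsol := hv.solvesOn.mono P.Ioi_subset_punctured
  have hune := hu.ne_zero_of_lt hE₁ hufin
  have hvne := hv.ne_zero_of_lt hE₂ hvfin
  have hudec := hu.mul_deriv_nonpos hE₁
  have hvdec := hv.mul_deriv_nonpos hE₂
  have hout := exterior_wronskian_nonpos husol hvsol
    (fun r _ => radialCoeff_le hℓ hE r) hune hvne hudec hvdec ha' hb' hc' hd'
  -- The matching makes `u(R⁺)` a multiple of `u(R⁻)`, and the former is nonzero by decay.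
  have ha0 : a ≠ 0 := by
    rintro rfl
    exact husol.limit_ne_zero hudec hune ha' (by simp [hab1])
  have hc0 : c ≠ 0 := by
    rintro rfl
    exact hvsol.limit_ne_zero hvdec hvne hc' (by simp [hcd1])
  have h1 : 2 - P.beta ≠ 0 := sub_ne_zero.2 hβ.symm
  have h2 : 2 + P.beta ≠ 0 := fun h => hβ' (by linarith)
  have h3 : 4 - P.beta ^ 2 ≠ 0 := by
    rw [show 4 - P.beta ^ 2 = (2 - P.beta) * (2 + P.beta) by ring]
    exact mul_ne_zero h1 h2
  by_contra! hlt
  -- Both matching matrices have determinant one and share `β`; they differ only through `α` in the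
  -- lower left entry, hence the single extra term.
  have hjump : a' * d' - b' * c' =
      (a * d - b * c) + 4 * (P.alpha ℓ₂ j₂ - P.alpha ℓ₁ j₁) / (2 - P.beta) ^ 2 * (a * c) := by
    rw [hab1, hab2, hcd1, hcd2]
    rw [show 4 - P.beta ^ 2 = (2 - P.beta) * (2 + P.beta) by ring]
    field_simp
    ring
  have hprod : a' * c' = ((2 + P.beta) / (2 - P.beta)) ^ 2 * (a * c) := by
    rw [hab1, hcd1]; ring
  have hα : 0 < P.alpha ℓ₂ j₂ - P.alpha ℓ₁ j₁ := sub_pos.2 hlt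
  rw [hjump, hprod] at hout
  have hs : 0 < ((2 + P.beta) / (2 - P.beta)) ^ 2 := by positivity
  have hpos : 0 < 4 * (P.alpha ℓ₂ j₂ - P.alpha ℓ₁ j₁) / (2 - P.beta) ^ 2 * (a * c) ^ 2 := by
    positivity
  have h4 : a * c * ((a * d - b * c) +
      4 * (P.alpha ℓ₂ j₂ - P.alpha ℓ₁ j₁) / (2 - P.beta) ^ 2 * (a * c)) ≤ 0 := by
    refine nonpos_of_mul_nonpos_right (a := ((2 + P.beta) / (2 - P.beta)) ^ 2) ?_ hs
    rwa [← mul_assoc]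
  linarith

/-! ### Spin-orbit coefficients and ordering of the energies -/

theorem alpha_add_half (P : ShellModel) (ℓ : ℕ) :
    P.alpha ℓ (ℓ + 1 / 2) = -(2 * P.mass / P.hbar ^ 2 * P.Vso) * (ℓ / 2) := by
  unfold alpha spinOrbit; ring

theorem alpha_sub_half (P : ShellModel) (ℓ : ℕ) :
    P.alpha ℓ (ℓ - 1 / 2) = 2 * P.mass / P.hbar ^ 2 * P.Vso * ((ℓ + 1) / 2) := by
  unfold alpha spinOrbit; ring

theorem alpha_add_half_lt_alpha_sub_half (P : ShellModel) (ℓ₁ ℓ₂ : ℕ) :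
    P.alpha ℓ₁ (ℓ₁ + 1 / 2) < P.alpha ℓ₂ (ℓ₂ - 1 / 2) := by
  have h1 := P.mass_pos
  have h2 := P.hbar_pos
  have h3 := P.Vso_pos
  rw [alpha_add_half, alpha_sub_half]
  have h4 : 0 < 2 * P.mass / P.hbar ^ 2 * P.Vso * (((ℓ₂ : ℝ) + 1) / 2) := by positivity
  have h5 : 0 ≤ 2 * P.mass / P.hbar ^ 2 * P.Vso * ((ℓ₁ : ℝ) / 2) := by positivity
  linarith

theorem neg_relativeEnergy_lt (hE₁ : E₁ < 0) (hE₂ : E₂ < 0) (h : E₁ < E₂) :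
    -(|E₁| / P.V0) < -(|E₂| / P.V0) := by
  rw [abs_of_neg hE₁, abs_of_neg hE₂, neg_lt_neg_iff]
  exact div_lt_div_of_pos_right (neg_lt_neg h) P.V0_pos

theorem IsRelativeEnergy.neg_lt_of_alpha_lt (hβ : P.beta ≠ 2) (hβ' : P.beta ≠ -2) {n : ℕ}
    {ε₁ ε₂ : ℝ} (h₁ : P.IsRelativeEnergy n ℓ₁ j₁ ε₁) (h₂ : P.IsRelativeEnergy n ℓ₂ j₂ ε₂)
    (hℓ : ℓ₁ ≤ ℓ₂) (hα : P.alpha ℓ₁ j₁ < P.alpha ℓ₂ j₂) : -ε₁ < -ε₂ := by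
  obtain ⟨E₁, u, -, hE₁, hu, hun, rfl⟩ := h₁
  obtain ⟨E₂, v, -, hE₂, hv, hvn, rfl⟩ := h₂
  refine neg_relativeEnergy_lt hE₁ hE₂ ?_
  by_contra! hE
  exact (alpha_le_of_encard_nodes_eq hβ hβ' hu hv hE₁ hE₂ (finite_of_encard_eq_coe hun)
    (finite_of_encard_eq_coe hvn) hℓ hE (hun.trans hvn.symm)).not_gt hα

theorem IsRelativeEnergy.neg_lt_of_lt {n₁ n₂ : ℕ} {ε₁ ε₂ : ℝ} (hn : n₁ < n₂)
    (h₁ : P.IsRelativeEnergy n₁ ℓ j ε₁) (h₂ : P.IsRelativeEnergy n₂ ℓ j ε₂) : -ε₁ < -ε₂ := by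
  obtain ⟨E₁, u, -, hE₁, hu, hun, rfl⟩ := h₁
  obtain ⟨E₂, v, -, hE₂, hv, hvn, rfl⟩ := h₂
  refine neg_relativeEnergy_lt hE₁ hE₂ ?_
  by_contra! hE
  have h := encard_nodes_le hu hv hE₁ hE₂ (finite_of_encard_eq_coe hun)
    (finite_of_encard_eq_coe hvn) le_rfl hE
  rw [hun, hvn] at h
  exact (Nat.cast_le.1 h).not_gt hn

end ShellModel

theorem theorem3 (P : ShellModel) (hβ : P.beta ≠ 2) (hβ' : P.beta ≠ -2) (n ℓ : ℕ) :
    (∀ j ε₁ ε₂ : ℝ, IsTotalAngularMomentum ℓ j →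
      P.IsRelativeEnergy n ℓ j ε₁ → P.IsRelativeEnergy (n + 1) ℓ j ε₂ → -ε₁ < -ε₂) ∧
    (∀ j ε₁ ε₂ : ℝ, j = ℓ + 1 / 2 →
      P.IsRelativeEnergy n ℓ j ε₁ → P.IsRelativeEnergy n (ℓ + 1) j ε₂ → -ε₁ < -ε₂) ∧
    (0 < ℓ → ∀ ε₁ ε₂ : ℝ,
      P.IsRelativeEnergy n ℓ (ℓ + 1 / 2) ε₁ → P.IsRelativeEnergy n ℓ (ℓ - 1 / 2) ε₂ →
      -ε₁ < -ε₂) := by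
  refine ⟨fun j ε₁ ε₂ _ h₁ h₂ => h₁.neg_lt_of_lt n.lt_succ_self h₂, ?_, ?_⟩
  · rintro j ε₁ ε₂ rfl h₁ h₂
    refine h₁.neg_lt_of_alpha_lt hβ hβ' h₂ ℓ.le_succ ?_
    -- The value `j = ℓ + 1/2` is the lower one, `(ℓ + 1) - 1/2`, for angular momentum `ℓ + 1`.
    have h := P.alpha_add_half_lt_alpha_sub_half ℓ (ℓ + 1)
    rwa [show (((ℓ + 1 : ℕ) : ℝ) - 1 / 2) = ℓ + 1 / 2 by push_cast; ring] at h
  · exact fun _ ε₁ ε₂ h₁ h₂ => h₁.neg_lt_of_alpha_lt hβ hβ' h₂ le_rfl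
      (P.alpha_add_half_lt_alpha_sub_half ℓ ℓ)
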